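/- Let $\epsilon\in\{-1,1\}$, $\lambda\in\{0,-\epsilon/2\}$, $n\ge 0$. Identify $(\mathbb{C}^\epsilon)^{n+2}$ with $\mathbb{R}^{2n+4}$ with coordinates $(z^1,z^2,w^1,w^2,x^a,y^a)_{1\le a\le n}$ and standard $\epsilon$-complex structure $J$: $J\partial_{z^1}=\partial_{z^2}$, $J\partial_{z^2}=\epsilon\,\partial_{z^1}$, and likewise for $(w^1,w^2)$ and each $(x^a,y^a)$. Put $$\|w\|_\lambda^2=\begin{cases}(w^1)^2-\epsilon (w^2)^2 & \text{if }\lambda=0,\\ (w^1)^2 & \text{if }\lambda=-\epsilon/2,\end{cases}\qquad \Delta^\epsilon=-\epsilon\frac{\partial^2}{\partial (w^1)^2}+\frac{\partial^2}{\partial (w^2)^2},$$ $\mathcal{S}=\{\|w\|_\lambda=0\}$ and $M=(\mathbb{C}^\epsilon)^{n+2}\setminus\mathcal{S}$. Let $R_0\in\mathbb{R}$ and let $b=b(w^1,w^2)$ be a smooth real function on $\{\|w\|_\lambda\ne 0\}\subset\mathbb{R}^2$ with $\Delta^\epsilon b=R_0/\|w\|_\lambda^4$. Endow $M$ with the metric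 $$g=dw^1dz^1-\epsilon\, dw^2dz^2+b\,(dw^1dw^1-\epsilon\, dw^2dw^2)+\sum_{a=1}^n(dx^adx^a-\epsilon\, dy^ady^a),$$ normalised so that $g(\partial_{w^1},\partial_{z^1})=1$, $g(\partial_{w^2},\partial_{z^2})=-\epsilon$, $g(\partial_{w^1},\partial_{w^1})=b$, $g(\partial_{w^2},\partial_{w^2})=-\epsilon b$, $g(\partial_{x^a},\partial_{x^a})=1$, $g(\partial_{y^a},\partial_{y^a})=-\epsilon$. Then $(M,g,J)$ is an $\epsilon$-Kähler manifold: $g$ is a pseudo-Riemannian metric, $J$ is $g$-skew-symmetric, $J^2=\epsilon$, and $\nabla J=0$ for the Levi-Civita connection $\nabla$ of $g$. Moreover, with $$\xi=\begin{cases}\dfrac{-1}{(w^1)^2-\epsilon (w^2)^2}\,\bigl(w^1\partial_{z^1}+w^2\partial_{z^2}\bigr) & \text{if }\lambda=0,\\[2mm] -\dfrac{1}{w^1}\,\partial_{z^1} & \text{if }\lambda=-\epsilon/2,\end{cases}\qquad \zeta=\lambda\xi,$$ the tensor field $$S_XY=g(X,Y)\xi-g(\xi,Y)X+\epsilon g(X,JY)J\xi-\epsilon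 g(\xi,JY)JX-2g(\zeta,JX)JY$$ is a degenerate homogeneous $\epsilon$-Kähler structure of linear type on $(M,g,J)$. That is, $g(\xi,\xi)=0$ and the connection $\tilde\nabla=\nabla-S$ satisfies $$\tilde\nabla g=0,\qquad \tilde\nabla R=0,\qquad \tilde\nabla S=0,\qquad \tilde\nabla J=0,$$ where $R$ is the curvature tensor of $g$. For $\lambda=0$ it is strongly degenerate, i.e. moreover $\zeta=0$. -/

import Mathlib

open scoped ContDiff

/-! ## Tensor calculus on an open subset of a real normed space

Throughout, `U` is an open subset of a real normed space `E`, regarded as a manifold with one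
global chart, so that every tangent space is `E`. A linear connection is given by its Christoffel
field `A : E → E →L[ℝ] E →L[ℝ] E`, that is, `∇_X Y = D_X Y + A (X, Y)`. The covariant derivatives
of tensor fields are written out on vectors `X, Y, Z, W` at the point `p` (equivalently, on
constant vector fields, which suffices because the expressions are tensorial). -/

section LocalGeometry

variable {E : Type*} [NormedAddCommGroup E] [NormedSpace ℝ E]

/-- `(∇_X g)(Y, Z)` for a `(0, 2)`-tensor field `g` and the connection `A`. -/
noncomputable def covDerivForm (A : E → E →L[ℝ] E →L[ℝ] E) (g : E → E →L[ℝ] E →L[ℝ] ℝ)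
    (p X Y Z : E) : ℝ :=
  fderiv ℝ g p X Y Z - g p (A p X Y) Z - g p Y (A p X Z)

/-- `(∇_X J) Y` for a `(1, 1)`-tensor field `J` and the connection `A`. -/
noncomputable def covDerivEndo (A : E → E →L[ℝ] E →L[ℝ] E) (J : E → E →L[ℝ] E)
    (p X Y : E) : E :=
  fderiv ℝ J p X Y + A p X (J p Y) - J p (A p X Y)

/-- `(∇_X S)_Y Z` for a `(1, 2)`-tensor field `S` and the connection `A`. -/
noncomputable def covDerivTensor (A S : E → E →L[ℝ] E →L[ℝ] E) (p X Y Z : E) : E :=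
  fderiv ℝ S p X Y Z + A p X (S p Y Z) - S p (A p X Y) Z - S p Y (A p X Z)

/-- The curvature `R_{X Y} Z = ∇_{[X, Y]} Z - [∇_X, ∇_Y] Z` of the connection `A`. -/
noncomputable def curvature (A : E → E →L[ℝ] E →L[ℝ] E) (p X Y Z : E) : E :=
  -((fderiv ℝ A p X Y Z + A p X (A p Y Z)) - (fderiv ℝ A p Y X Z + A p Y (A p X Z)))

/-- `(∇_X R)_{Y Z} W` for a `(1, 3)`-tensor field `R` and the connection `A`. -/
noncomputable def covDerivCurvature (A : E → E →L[ℝ] E →L[ℝ] E) (R : E → E → E → E → E)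
    (p X Y Z W : E) : E :=
  fderiv ℝ (fun q => R q Y Z W) p X + A p X (R p Y Z W)
    - R p (A p X Y) Z W - R p Y (A p X Z) W - R p Y Z (A p X W)

/-- `g` is a smooth pseudo-Riemannian metric (of any signature) on the open set `U`. -/
structure IsPseudoRiemannian (U : Set E) (g : E → E →L[ℝ] E →L[ℝ] ℝ) : Prop where
  isOpen : IsOpen U
  smooth : ContDiffOn ℝ ∞ g U
  symm : ∀ p ∈ U, ∀ X Y, g p X Y = g p Y X
  nondegenerate : ∀ p ∈ U, ∀ X, (∀ Y, g p X Y = 0) → X = 0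

/-- `A` is the Levi-Civita connection of `g` on `U`: smooth, torsion-free, and `∇ g = 0`. -/
structure IsLeviCivita (U : Set E) (g : E → E →L[ℝ] E →L[ℝ] ℝ)
    (A : E → E →L[ℝ] E →L[ℝ] E) : Prop where
  smooth : ContDiffOn ℝ ∞ A U
  torsionFree : ∀ p ∈ U, ∀ X Y, A p X Y = A p Y X
  metric : ∀ p ∈ U, ∀ X Y Z, covDerivForm A g p X Y Z = 0

/-- The Levi-Civita connection is unique on `U`. Hence the existential quantifiers over it in the
definitions below involve no choice. -/
theorem IsLeviCivita.unique {U : Set E} {g : E → E →L[ℝ] E →L[ℝ] ℝ}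
    (hg : IsPseudoRiemannian U g) {A B : E → E →L[ℝ] E →L[ℝ] E}
    (hA : IsLeviCivita U g A) (hB : IsLeviCivita U g B) :
    ∀ p ∈ U, A p = B p := by
  intro p hp
  ext X Y
  rw [← sub_eq_zero]
  apply hg.nondegenerate p hp
  intro Z
  have key : ∀ C : E → E →L[ℝ] E →L[ℝ] E, IsLeviCivita U g C →
      2 * g p (C p X Y) Z =
        fderiv ℝ g p X Y Z + fderiv ℝ g p Y X Z - fderiv ℝ g p Z X Y := by
    intro C hC
    have h1 := hC.metric p hp X Y Z
    have h2 := hC.metric p hp Y X Z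
    have h3 := hC.metric p hp Z X Y
    simp only [covDerivForm] at h1 h2 h3
    rw [hC.torsionFree p hp Y X] at h2
    rw [hC.torsionFree p hp Z X, hC.torsionFree p hp Z Y, hg.symm p hp (C p X Z) Y] at h3
    rw [hg.symm p hp X (C p Y Z)] at h2 h3
    linarith
  have h1 := key A hA
  have h2 := key B hB
  simp only [map_sub, sub_apply]
  linarith

/-- `(U, g, J)` is an `ε`-Kähler manifold: `J` is a smooth section of `𝔰𝔬(TU)` with `J² = ε`
which is parallel for the Levi-Civita connection of `g`. -/
structure IsEpsKahler (ε : ℝ) (U : Set E) (g : E → E →L[ℝ] E →L[ℝ] ℝ)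
    (J : E → E →L[ℝ] E) : Prop where
  metric : IsPseudoRiemannian U g
  smooth : ContDiffOn ℝ ∞ J U
  skew : ∀ p ∈ U, ∀ X Y, g p (J p X) Y = -g p X (J p Y)
  sq : ∀ p ∈ U, ∀ X, J p (J p X) = ε • X
  parallel : ∃ A, IsLeviCivita U g A ∧ ∀ p ∈ U, ∀ X Y, covDerivEndo A J p X Y = 0

/-- `S` is a homogeneous `ε`-Kähler structure on `(U, g, J)`: a smooth `(1, 2)`-tensor field on an
`ε`-Kähler manifold such that the metric `g`, the curvature tensor `R` of `g`, the tensor `S`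
and `J` are parallel with respect to `∇ - S`, where `∇` is the Levi-Civita connection of `g`. -/
structure IsHomogeneousEpsKahlerStructure (ε : ℝ) (U : Set E) (g : E → E →L[ℝ] E →L[ℝ] ℝ)
    (J : E → E →L[ℝ] E) (S : E → E →L[ℝ] E →L[ℝ] E) : Prop where
  kahler : IsEpsKahler ε U g J
  smooth : ContDiffOn ℝ ∞ S U
  ambroseSinger : ∃ A, IsLeviCivita U g A ∧
    (∀ p ∈ U, ∀ X Y Z, covDerivForm (A - S) g p X Y Z = 0) ∧
    (∀ p ∈ U, ∀ X Y Z W, covDerivCurvature (A - S) (curvature A) p X Y Z W = 0) ∧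
    (∀ p ∈ U, ∀ X Y Z, covDerivTensor (A - S) S p X Y Z = 0) ∧
    (∀ p ∈ U, ∀ X Y, covDerivEndo (A - S) J p X Y = 0)

/-- `S` is a homogeneous `ε`-Kähler structure of linear type, given by the vector fields `ξ`
and `ζ`. -/
structure IsLinearType (ε : ℝ) (U : Set E) (g : E → E →L[ℝ] E →L[ℝ] ℝ)
    (J : E → E →L[ℝ] E) (ξ ζ : E → E) (S : E → E →L[ℝ] E →L[ℝ] E) : Prop where
  homogeneous : IsHomogeneousEpsKahlerStructure ε U g J S
  smooth_xi : ContDiffOn ℝ ∞ ξ U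
  smooth_zeta : ContDiffOn ℝ ∞ ζ U
  formula : ∀ p ∈ U, ∀ X Y, S p X Y =
    g p X Y • ξ p - g p (ξ p) Y • X
      + (ε * g p X (J p Y)) • J p (ξ p) - (ε * g p (ξ p) (J p Y)) • J p X
      - (2 * g p (ζ p) (J p X)) • J p Y

/-- `S` is a degenerate homogeneous `ε`-Kähler structure of linear type: `g(ξ, ξ) = 0`. -/
structure IsDegenerateLinearType (ε : ℝ) (U : Set E) (g : E → E →L[ℝ] E →L[ℝ] ℝ)
    (J : E → E →L[ℝ] E) (ξ ζ : E → E) (S : E → E →L[ℝ] E →L[ℝ] E) : Prop where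
  linearType : IsLinearType ε U g J ξ ζ S
  null : ∀ p ∈ U, g p (ξ p) (ξ p) = 0

/-- `S` is strongly degenerate: `g(ξ, ξ) = 0` and `ζ = 0`. -/
structure IsStronglyDegenerateLinearType (ε : ℝ) (U : Set E) (g : E → E →L[ℝ] E →L[ℝ] ℝ)
    (J : E → E →L[ℝ] E) (ξ ζ : E → E) (S : E → E →L[ℝ] E →L[ℝ] E) : Prop where
  degenerate : IsDegenerateLinearType ε U g J ξ ζ S
  zeta_eq_zero : ∀ p ∈ U, ζ p = 0

end LocalGeometry

/-! ## The local model -/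

/-- The real vector space underlying `(ℂ^ε)^(n+2)`: a point is
`((z¹, z²), (w¹, w²), (x^a, y^a)_a)`. -/
abbrev EpsSpace (n : ℕ) : Type := (ℝ × ℝ) × (ℝ × ℝ) × (Fin n → ℝ × ℝ)

namespace EpsSpace

variable {n : ℕ}

/-- The `ℂ^ε`-coordinate `z = (z¹, z²)`. -/
def zCoord : EpsSpace n →L[ℝ] ℝ × ℝ := ContinuousLinearMap.fst ℝ _ _

/-- The `ℂ^ε`-coordinate `w = (w¹, w²)`. -/
def wCoord : EpsSpace n →L[ℝ] ℝ × ℝ :=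
  (ContinuousLinearMap.fst ℝ _ _).comp (ContinuousLinearMap.snd ℝ _ _)

/-- The `ℂ^ε`-coordinate `(x^a, y^a)`. -/
def uCoord (a : Fin n) : EpsSpace n →L[ℝ] ℝ × ℝ :=
  (ContinuousLinearMap.proj a).comp
    ((ContinuousLinearMap.snd ℝ _ _).comp (ContinuousLinearMap.snd ℝ _ _))

/-- The coordinate one-form `dz¹`. -/
def dz1 : EpsSpace n →L[ℝ] ℝ := (ContinuousLinearMap.fst ℝ ℝ ℝ).comp zCoord

/-- The coordinate one-form `dz²`. -/
def dz2 : EpsSpace n →L[ℝ] ℝ := (ContinuousLinearMap.snd ℝ ℝ ℝ).comp zCoord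

/-- The coordinate one-form `dw¹`. -/
def dw1 : EpsSpace n →L[ℝ] ℝ := (ContinuousLinearMap.fst ℝ ℝ ℝ).comp wCoord

/-- The coordinate one-form `dw²`. -/
def dw2 : EpsSpace n →L[ℝ] ℝ := (ContinuousLinearMap.snd ℝ ℝ ℝ).comp wCoord

/-- The coordinate one-form `dx^a`. -/
def dx (a : Fin n) : EpsSpace n →L[ℝ] ℝ := (ContinuousLinearMap.fst ℝ ℝ ℝ).comp (uCoord a)

/-- The coordinate one-form `dy^a`. -/
def dy (a : Fin n) : EpsSpace n →L[ℝ] ℝ := (ContinuousLinearMap.snd ℝ ℝ ℝ).comp (uCoord a)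

/-- The coordinate vector `∂_{z¹}`. -/
def partialZ1 : EpsSpace n := ((1, 0), 0, 0)

/-- The coordinate vector `∂_{z²}`. -/
def partialZ2 : EpsSpace n := ((0, 1), 0, 0)

/-- The tensor product `α ⊗ β` of two covectors, `(X, Y) ↦ α(X) β(Y)`. -/
noncomputable def tensor (α β : EpsSpace n →L[ℝ] ℝ) : EpsSpace n →L[ℝ] EpsSpace n →L[ℝ] ℝ :=
  α.smulRight β

/-- Multiplication by the `ε`-complex imaginary unit on `ℂ^ε`: `∂_1 ↦ ∂_2`, `∂_2 ↦ ε ∂_1`. -/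
noncomputable def mulI (ε : ℝ) : ℝ × ℝ →L[ℝ] ℝ × ℝ :=
  (ε • ContinuousLinearMap.snd ℝ ℝ ℝ).prod (ContinuousLinearMap.fst ℝ ℝ ℝ)

/-- The standard `ε`-complex structure `J₀` of `(ℂ^ε)^(n+2)`. -/
noncomputable def stdJ (ε : ℝ) : EpsSpace n →L[ℝ] EpsSpace n :=
  ((mulI ε).comp zCoord).prod
    (((mulI ε).comp wCoord).prod (ContinuousLinearMap.pi fun a => (mulI ε).comp (uCoord a)))

/-- The metric
`dw¹ dz¹ - ε dw² dz² + b (dw¹ dw¹ - ε dw² dw²) + ∑ₐ (dx^a dx^a - ε dy^a dy^a)`, normalised so that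
`g(∂_{w¹}, ∂_{z¹}) = 1`, `g(∂_{w²}, ∂_{z²}) = -ε`, `g(∂_{w¹}, ∂_{w¹}) = b`. -/
noncomputable def metric (ε : ℝ) (b : ℝ × ℝ → ℝ) (p : EpsSpace n) :
    EpsSpace n →L[ℝ] EpsSpace n →L[ℝ] ℝ :=
  (tensor dw1 dz1 + tensor dz1 dw1) - ε • (tensor dw2 dz2 + tensor dz2 dw2)
    + b (wCoord p) • (tensor dw1 dw1 - ε • tensor dw2 dw2)
    + ∑ a : Fin n, (tensor (dx a) (dx a) - ε • tensor (dy a) (dy a))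

/-- `‖w‖_λ²`, which is `(w¹)² - ε (w²)²` for `λ = 0` and `(w¹)²` for the other value
`λ = -ε/2`. -/
noncomputable def normSq (ε lam : ℝ) (w : ℝ × ℝ) : ℝ :=
  if lam = 0 then w.1 ^ 2 - ε * w.2 ^ 2 else w.1 ^ 2

/-- The operator `Δ^ε = -ε ∂²/∂(w¹)² + ∂²/∂(w²)²`. -/
noncomputable def epsLaplacian (ε : ℝ) (b : ℝ × ℝ → ℝ) (w : ℝ × ℝ) : ℝ :=
  -ε * fderiv ℝ (fun v => fderiv ℝ b v (1, 0)) w (1, 0)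
    + fderiv ℝ (fun v => fderiv ℝ b v (0, 1)) w (0, 1)

/-- The complement of the singular set `‖w‖_λ = 0` in `(ℂ^ε)^(n+2)`. -/
def regularSet (n : ℕ) (ε lam : ℝ) : Set (EpsSpace n) := {p | normSq ε lam (wCoord p) ≠ 0}

/-- The vector field `ξ`: it is `-((w¹)² - ε (w²)²)⁻¹ (w¹ ∂_{z¹} + w² ∂_{z²})` for `λ = 0` and
`-(w¹)⁻¹ ∂_{z¹}` for the other value `λ = -ε/2`. -/
noncomputable def xi (ε lam : ℝ) (p : EpsSpace n) : EpsSpace n :=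
  if lam = 0 then
    (-1 / (dw1 p ^ 2 - ε * dw2 p ^ 2)) • (dw1 p • partialZ1 + dw2 p • partialZ2)
  else (-1 / dw1 p) • partialZ1

end EpsSpace

/-! ### Algebra and parallelism of tensors of linear type. -/

section LinearType

variable {E : Type*} [NormedAddCommGroup E] [NormedSpace ℝ E]

/-! Write i for the unit of ℂ^ε, so i² = ε. The Christoffel field of g is Γ(X, Y) = φ Xʷ Yʷ ∂_z with
φ = ∂b/∂w: it sees only w-components and takes values in the z-directions. Hence the quadratic terms
of the curvature vanish, and R is the function h = (ε/2) Δ^ε b times a tensor with constant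
coefficients (`curvature_christoffel`).

For ∇ - S, the forms g and J cost nothing: each S_X is skew and commutes with J
(`linearTypeTensor_skew`, `linearTypeTensor_comm`). Since S is built algebraically from g, J, ξ and
ζ = λξ, it is parallel as soon as ξ is (`covDerivTensor_linearTypeTensor`). Only ξ and R remain.

For ξ = x ∂_z with x = x₁ + i x₂, the field Γ - S multiplies w-components by -(α + iβ) and ∂_z by α
- iβ, where α and β are real one-forms linear in x. So ξ is parallel iff dx = -(α - iβ) x, and R is
parallel once dh = -4αh (`covDerivCurvature_eq_zero`, assembled in
`isDegenerateLinearType_of_structureEquations`).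

For λ = 0, x = -1/w̄ gives α + iβ = dw/w. For λ = -ε/2, the factor 1 + 2λε of β vanishes and x =
-1/w¹ gives α = dw¹/w¹. In both cases h is a constant over ‖w‖⁴, and both equations hold. Nullity of
ξ is clear, as the z-directions are isotropic. -/

/-- The `(1, 2)`-tensor of linear type given by the form `g`, the endomorphism `J` and the
vectors `ξ`, `ζ`. -/
noncomputable def linearTypeTensor (ε : ℝ) (g : E →L[ℝ] E →L[ℝ] ℝ) (J : E →L[ℝ] E) (ξ ζ : E) :
    E →L[ℝ] E →L[ℝ] E :=
  ((ContinuousLinearMap.smulRightL ℝ E E).flip ξ).comp g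
    - ContinuousLinearMap.smulRightL ℝ E E (g ξ)
    + ε • ((ContinuousLinearMap.smulRightL ℝ E E).flip (J ξ)).comp
        (((ContinuousLinearMap.compL ℝ E E ℝ).flip J).comp g)
    - ε • (ContinuousLinearMap.smulRightL ℝ E E ((g ξ).comp J)).comp J
    - (2 : ℝ) • ((g ζ).comp J).smulRight J

theorem linearTypeTensor_apply (ε : ℝ) (g : E →L[ℝ] E →L[ℝ] ℝ) (J : E →L[ℝ] E) (ξ ζ X Y : E) :
    linearTypeTensor ε g J ξ ζ X Y =
      g X Y • ξ - g ξ Y • X + (ε * g X (J Y)) • J ξ - (ε * g ξ (J Y)) • J X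
        - (2 * g ζ (J X)) • J Y := by
  simp [linearTypeTensor, mul_smul]

theorem contDiffOn_linearTypeTensor {ε : ℝ} {U : Set E} {g : E → E →L[ℝ] E →L[ℝ] ℝ}
    {J : E →L[ℝ] E} {ξ ζ : E → E} (hg : ContDiffOn ℝ ∞ g U) (hξ : ContDiffOn ℝ ∞ ξ U)
    (hζ : ContDiffOn ℝ ∞ ζ U) :
    ContDiffOn ℝ ∞ (fun p => linearTypeTensor ε (g p) J (ξ p) (ζ p)) U := by
  have hgξ : ContDiffOn ℝ ∞ (fun p => g p (ξ p)) U := hg.clm_apply hξ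
  have hgζ : ContDiffOn ℝ ∞ (fun p => g p (ζ p)) U := hg.clm_apply hζ
  have hJξ : ContDiffOn ℝ ∞ (fun p => J (ξ p)) U := J.contDiff.comp_contDiffOn hξ
  have h1 : ContDiffOn ℝ ∞ (fun p => (ContinuousLinearMap.smulRightL ℝ E E).flip (ξ p)) U :=
    contDiffOn_const.clm_apply hξ
  have h2 : ContDiffOn ℝ ∞ (fun p => (ContinuousLinearMap.smulRightL ℝ E E) (g p (ξ p))) U :=
    (ContinuousLinearMap.smulRightL ℝ E E).contDiff.comp_contDiffOn hgξ
  have h3 : ContDiffOn ℝ ∞ (fun p => (ContinuousLinearMap.smulRightL ℝ E E).flip (J (ξ p))) U :=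
    contDiffOn_const.clm_apply hJξ
  have h4 : ContDiffOn ℝ ∞
      (fun p => (ContinuousLinearMap.smulRightL ℝ E E) ((g p (ξ p)).comp J)) U :=
    (ContinuousLinearMap.smulRightL ℝ E E).contDiff.comp_contDiffOn
      (hgξ.clm_comp contDiffOn_const)
  have h5 : ContDiffOn ℝ ∞ (fun p => ((g p (ζ p)).comp J).smulRight J) U :=
    (hgζ.clm_comp contDiffOn_const).smulRight contDiffOn_const
  exact ((((h1.clm_comp hg).sub h2).add
    ((h3.clm_comp (contDiffOn_const.clm_comp hg)).const_smul ε)).sub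
    ((h4.clm_comp contDiffOn_const).const_smul ε)).sub
    (h5.const_smul (2 : ℝ))

/-- The endomorphisms `S_X` of a tensor of linear type are skew-symmetric. -/
theorem linearTypeTensor_skew {ε : ℝ} {g : E →L[ℝ] E →L[ℝ] ℝ} {J : E →L[ℝ] E}
    (symm : ∀ X Y, g X Y = g Y X) (skew : ∀ X Y, g (J X) Y = -g X (J Y)) (ξ ζ X Y Z : E) :
    g (linearTypeTensor ε g J ξ ζ X Y) Z + g Y (linearTypeTensor ε g J ξ ζ X Z) = 0 := by
  rw [symm Y]
  simp only [linearTypeTensor_apply, map_add, map_sub, map_smul, add_apply, sub_apply,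
    smul_apply, smul_eq_mul, skew]
  rw [symm Z (J Y), skew Y Z]
  ring

/-- The endomorphisms `S_X` of a tensor of linear type commute with `J`. -/
theorem linearTypeTensor_comm {ε : ℝ} {g : E →L[ℝ] E →L[ℝ] ℝ} {J : E →L[ℝ] E} (hε : ε * ε = 1)
    (sq : ∀ X, J (J X) = ε • X) (ξ ζ X Y : E) :
    linearTypeTensor ε g J ξ ζ X (J Y) = J (linearTypeTensor ε g J ξ ζ X Y) := by
  simp only [linearTypeTensor_apply, map_add, map_sub, map_smul, smul_eq_mul, sq, smul_smul]
  have h1 : ∀ t : ℝ, ε * (ε * t) = t := fun t => by rw [← mul_assoc, hε, one_mul]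
  have h2 : ∀ t : ℝ, ε * t * ε = t := fun t => by rw [mul_right_comm, hε, one_mul]
  simp only [h1, h2]
  module

/-- A tensor of linear type is parallel for every connection for which `g`, `J` and `ξ` are
parallel, if `ζ` is a constant multiple of `ξ`. -/
theorem covDerivTensor_linearTypeTensor {ε lam : ℝ} {g : E → E →L[ℝ] E →L[ℝ] ℝ} {J : E →L[ℝ] E}
    {ξ : E → E} {B : E → E →L[ℝ] E →L[ℝ] E} {p : E}
    (hg : DifferentiableAt ℝ g p) (hξ : DifferentiableAt ℝ ξ p)
    (hS : DifferentiableAt ℝ (fun q => linearTypeTensor ε (g q) J (ξ q) (lam • ξ q)) p)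
    (parallel_g : ∀ X Y Z, covDerivForm B g p X Y Z = 0)
    (parallel_J : ∀ X Y, B p X (J Y) = J (B p X Y))
    (parallel_ξ : ∀ X, fderiv ℝ ξ p X = -B p X (ξ p)) (X Y Z : E) :
    covDerivTensor B (fun q => linearTypeTensor ε (g q) J (ξ q) (lam • ξ q)) p X Y Z = 0 := by
  have hg' : ∀ X Y Z, fderiv ℝ g p X Y Z = g p (B p X Y) Z + g p Y (B p X Z) := fun X Y Z => by
    have := parallel_g X Y Z
    simp only [covDerivForm] at this
    linarith
  have dg : ∀ u v : E, HasFDerivAt (fun q => g q u v)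
      (((fderiv ℝ g p).flip u).flip v) p := fun u v => by
    have := (hg.hasFDerivAt.clm_apply (hasFDerivAt_const u p)).clm_apply (hasFDerivAt_const v p)
    refine this.congr_fderiv ?_
    ext; simp
  have dgξ : ∀ v : E, HasFDerivAt (fun q => g q (ξ q) v)
      ((((fderiv ℝ g p).flip (ξ p)) + (g p).comp (fderiv ℝ ξ p)).flip v) p := fun v => by
    have := (hg.hasFDerivAt.clm_apply hξ.hasFDerivAt).clm_apply (hasFDerivAt_const v p)
    refine this.congr_fderiv ?_
    ext; simp [add_comm]
  have dξ := hξ.hasFDerivAt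
  have dJξ : HasFDerivAt (fun q => J (ξ q)) (J.comp (fderiv ℝ ξ p)) p :=
    J.hasFDerivAt.comp p dξ
  -- With Y and Z frozen, S is a sum of five scalar-times-vector products; ζ = λξ turns the last
  -- coefficient into 2λ g(ξ, JY), so no separate derivative of ζ is needed.
  have main := ((((dg Y Z).smul dξ).sub ((dgξ Z).smul (hasFDerivAt_const Y p))).add
    (((dg Y (J Z)).const_mul ε).smul dJξ)).sub
    (((dgξ (J Z)).const_mul ε).smul (hasFDerivAt_const (J Y) p)) |>.sub
    (((dgξ (J Y)).const_mul (2 * lam)).smul (hasFDerivAt_const (J Z) p))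
  have hder : fderiv ℝ (fun q => linearTypeTensor ε (g q) J (ξ q) (lam • ξ q)) p X Y Z =
      fderiv ℝ (fun q => linearTypeTensor ε (g q) J (ξ q) (lam • ξ q) Y Z) p X := by
    have := (hS.hasFDerivAt.clm_apply (hasFDerivAt_const Y p)).clm_apply (hasFDerivAt_const Z p)
    rw [this.fderiv]
    simp
  have hder' := main.congr_of_eventuallyEq
    (f₁ := fun q => linearTypeTensor ε (g q) J (ξ q) (lam • ξ q) Y Z)
    (.of_forall fun q => by simp [linearTypeTensor_apply, mul_assoc])
  rw [covDerivTensor, hder, hder'.fderiv]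
  simp only [linearTypeTensor_apply, add_apply, sub_apply, smul_apply, smul_zero, zero_add,
    ContinuousLinearMap.smulRight_apply, ContinuousLinearMap.flip_apply,
    ContinuousLinearMap.comp_apply, hg', parallel_ξ, map_neg, map_add,
    map_sub, map_smul, parallel_J, neg_apply, smul_eq_mul]
  module

end LinearType

/-! ### Derivatives of tensor fields whose coefficients factor through a linear projection. -/

section Calculus

variable {E F G : Type*} [NormedAddCommGroup E] [NormedSpace ℝ E] [NormedAddCommGroup F]
  [NormedSpace ℝ F] [NormedAddCommGroup G] [NormedSpace ℝ G]

/-- The shape of the metric: constant tensors, plus one varying coefficient b(w). -/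
theorem hasFDerivAt_add_comp_smul_add {f : F → ℝ} {L : E →L[ℝ] F} {p : E}
    (hf : DifferentiableAt ℝ f (L p)) (c₀ c₁ c₂ : G) :
    HasFDerivAt (fun q => c₀ + f (L q) • c₁ + c₂)
      (((fderiv ℝ f (L p)).comp L).smulRight c₁) p :=
  (((hf.hasFDerivAt.comp p L.hasFDerivAt).smul_const c₁).const_add c₀).add_const c₂

theorem contDiffOn_add_comp_smul_add {f : F → ℝ} {L : E →L[ℝ] F} {V : Set F}
    (hf : ContDiffOn ℝ ∞ f V) (c₀ c₁ c₂ : G) :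
    ContDiffOn ℝ ∞ (fun q => c₀ + f (L q) • c₁ + c₂) (L ⁻¹' V) :=
  (contDiffOn_const.add ((hf.comp L.contDiff.contDiffOn (Set.mapsTo_preimage _ _)).smul
    contDiffOn_const)).add contDiffOn_const

/-- The shape of the Christoffel field: two constant tensors, with the partial derivatives of b as
coefficients. -/
theorem fderiv_comp_smul_add_comp_smul {f₁ f₂ : F → ℝ} {L : E →L[ℝ] F} {p : E}
    (hf₁ : DifferentiableAt ℝ f₁ (L p)) (hf₂ : DifferentiableAt ℝ f₂ (L p)) (c₁ c₂ : G) (v : E) :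
    fderiv ℝ (fun q => f₁ (L q) • c₁ + f₂ (L q) • c₂) p v =
      fderiv ℝ f₁ (L p) (L v) • c₁ + fderiv ℝ f₂ (L p) (L v) • c₂ := by
  have := ((hf₁.hasFDerivAt.comp p L.hasFDerivAt).smul_const c₁).add
    ((hf₂.hasFDerivAt.comp p L.hasFDerivAt).smul_const c₂)
  exact congrArg (fun T : E →L[ℝ] G => T v) this.fderiv

theorem contDiffOn_comp_smul_add_comp_smul {f₁ f₂ : F → ℝ} {L : E →L[ℝ] F} {V : Set F}
    (hf₁ : ContDiffOn ℝ ∞ f₁ V) (hf₂ : ContDiffOn ℝ ∞ f₂ V) (c₁ c₂ : G) :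
    ContDiffOn ℝ ∞ (fun q => f₁ (L q) • c₁ + f₂ (L q) • c₂) (L ⁻¹' V) :=
  ((hf₁.comp L.contDiff.contDiffOn (Set.mapsTo_preimage _ _)).smul contDiffOn_const).add
    ((hf₂.comp L.contDiff.contDiffOn (Set.mapsTo_preimage _ _)).smul contDiffOn_const)

end Calculus

/-! ### The model metric and its compatibility with J. -/

namespace EpsSpace

variable {n : ℕ}

@[simp] theorem dz1_apply (X : EpsSpace n) : dz1 X = X.1.1 := rfl
@[simp] theorem dz2_apply (X : EpsSpace n) : dz2 X = X.1.2 := rfl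
@[simp] theorem dw1_apply (X : EpsSpace n) : dw1 X = X.2.1.1 := rfl
@[simp] theorem dw2_apply (X : EpsSpace n) : dw2 X = X.2.1.2 := rfl
@[simp] theorem dx_apply (a : Fin n) (X : EpsSpace n) : dx a X = (X.2.2 a).1 := rfl
@[simp] theorem dy_apply (a : Fin n) (X : EpsSpace n) : dy a X = (X.2.2 a).2 := rfl
@[simp] theorem wCoord_apply (X : EpsSpace n) : wCoord X = X.2.1 := rfl

theorem stdJ_apply (ε : ℝ) (X : EpsSpace n) :
    stdJ ε X = ((ε * X.1.2, X.1.1), (ε * X.2.1.2, X.2.1.1),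
      fun a => (ε * (X.2.2 a).2, (X.2.2 a).1)) := rfl

theorem metric_apply (ε : ℝ) (b : ℝ × ℝ → ℝ) (p X Y : EpsSpace n) :
    metric ε b p X Y = X.2.1.1 * Y.1.1 + X.1.1 * Y.2.1.1
      - ε * (X.2.1.2 * Y.1.2 + X.1.2 * Y.2.1.2)
      + b p.2.1 * (X.2.1.1 * Y.2.1.1 - ε * (X.2.1.2 * Y.2.1.2))
      + ∑ a, ((X.2.2 a).1 * (Y.2.2 a).1 - ε * ((X.2.2 a).2 * (Y.2.2 a).2)) := by
  simp [metric, tensor, mul_add]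

theorem metric_symm (ε : ℝ) (b : ℝ × ℝ → ℝ) (p X Y : EpsSpace n) :
    metric ε b p X Y = metric ε b p Y X := by
  simp only [metric_apply]
  congr 1
  · ring
  · exact Finset.sum_congr rfl fun a _ => by ring

theorem metric_stdJ_skew (ε : ℝ) (b : ℝ × ℝ → ℝ) (p X Y : EpsSpace n) :
    metric ε b p (stdJ ε X) Y = -metric ε b p X (stdJ ε Y) := by
  simp only [metric_apply, stdJ_apply, neg_add, ← Finset.sum_neg_distrib]
  congr 1
  · ring
  · exact Finset.sum_congr rfl fun a _ => by ring

theorem stdJ_stdJ (ε : ℝ) (X : EpsSpace n) : stdJ ε (stdJ ε X) = ε • X := by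
  simp only [stdJ_apply]
  rfl

theorem metric_nondegenerate {ε : ℝ} (hε : ε ≠ 0) (b : ℝ × ℝ → ℝ) (p X : EpsSpace n)
    (h : ∀ Y, metric ε b p X Y = 0) : X = 0 := by
  -- The order matters: pairing with ∂_z isolates the w-components of X, and once these vanish the
  -- b-terms drop out of the pairing with ∂_w.
  have w1 : X.2.1.1 = 0 := by simpa [metric_apply] using h ((1, 0), 0, 0)
  have w2 : X.2.1.2 = 0 := by simpa [metric_apply, hε] using h ((0, 1), 0, 0)
  have z1 : X.1.1 = 0 := by simpa [metric_apply, w1] using h (0, (1, 0), 0)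
  have z2 : X.1.2 = 0 := by simpa [metric_apply, w2, hε] using h (0, (0, 1), 0)
  have x (a : Fin n) : (X.2.2 a).1 = 0 := by
    have := h (0, 0, Pi.single a (1, 0))
    simpa [metric_apply, Pi.single_apply, apply_ite Prod.fst, apply_ite Prod.snd] using this
  have y (a : Fin n) : (X.2.2 a).2 = 0 := by
    have := h (0, 0, Pi.single a (0, 1))
    simpa [metric_apply, Pi.single_apply, apply_ite Prod.fst, apply_ite Prod.snd, hε] using this
  exact Prod.ext (Prod.ext z1 z2)
    (Prod.ext (Prod.ext w1 w2) (funext fun a => Prod.ext (x a) (y a)))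

theorem hasFDerivAt_metric {ε : ℝ} {b : ℝ × ℝ → ℝ} {p : EpsSpace n}
    (hb : DifferentiableAt ℝ b (wCoord p)) :
    HasFDerivAt (metric ε b) (((fderiv ℝ b (wCoord p)).comp wCoord).smulRight
      (tensor dw1 dw1 - ε • tensor dw2 dw2)) p :=
  hasFDerivAt_add_comp_smul_add hb
    ((tensor dw1 dz1 + tensor dz1 dw1) - ε • (tensor dw2 dz2 + tensor dz2 dw2)) _
    (∑ a : Fin n, (tensor (dx a) (dx a) - ε • tensor (dy a) (dy a)))

theorem contDiffOn_metric {ε : ℝ} {b : ℝ × ℝ → ℝ} {V : Set (ℝ × ℝ)} (hb : ContDiffOn ℝ ∞ b V) :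
    ContDiffOn ℝ ∞ (metric (n := n) ε b) (wCoord ⁻¹' V) :=
  contDiffOn_add_comp_smul_add hb _ _ _

/-! ### The Levi-Civita connection of the model. -/

/-- The product `(Xʷ Yʷ) ∂_z` in `ℂ^ε`, a `(1, 2)`-tensor. -/
noncomputable def mulZ (ε : ℝ) : EpsSpace n →L[ℝ] EpsSpace n →L[ℝ] EpsSpace n :=
  ((ContinuousLinearMap.smulRightL ℝ _ _).flip partialZ1).comp
      (tensor dw1 dw1 + ε • tensor dw2 dw2)
    + ((ContinuousLinearMap.smulRightL ℝ _ _).flip partialZ2).comp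
      (tensor dw1 dw2 + tensor dw2 dw1)

theorem mulZ_apply (ε : ℝ) (X Y : EpsSpace n) :
    mulZ ε X Y = ((X.2.1.1 * Y.2.1.1 + ε * (X.2.1.2 * Y.2.1.2),
      X.2.1.1 * Y.2.1.2 + X.2.1.2 * Y.2.1.1), 0, 0) := by
  simp [mulZ, tensor, partialZ1, partialZ2]

/-- The product `(i Xʷ Yʷ) ∂_z` in `ℂ^ε`, a `(1, 2)`-tensor. -/
noncomputable def mulIZ (ε : ℝ) : EpsSpace n →L[ℝ] EpsSpace n →L[ℝ] EpsSpace n :=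
  (ContinuousLinearMap.compL ℝ _ _ _ (stdJ ε)).comp (mulZ ε)

theorem mulIZ_apply (ε : ℝ) (X Y : EpsSpace n) : mulIZ ε X Y = stdJ ε (mulZ ε X Y) := rfl

/-- The Christoffel field of the metric: in `ℂ^ε` it is `½ (∂b/∂w¹ + i ε ∂b/∂w²) Xʷ Yʷ ∂_z`. -/
noncomputable def christoffel (ε : ℝ) (b : ℝ × ℝ → ℝ) (p : EpsSpace n) :
    EpsSpace n →L[ℝ] EpsSpace n →L[ℝ] EpsSpace n :=
  (fderiv ℝ b (wCoord p) (1, 0)) • ((1 / 2 : ℝ) • mulZ ε)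
    + (fderiv ℝ b (wCoord p) (0, 1)) •
      ((ε / 2) • mulIZ ε)

theorem christoffel_apply (ε : ℝ) (b : ℝ × ℝ → ℝ) (p X Y : EpsSpace n) :
    christoffel ε b p X Y = (fderiv ℝ b p.2.1 (1, 0) / 2) • mulZ ε X Y
      + (ε * fderiv ℝ b p.2.1 (0, 1) / 2) • stdJ ε (mulZ ε X Y) := by
  simp only [christoffel, wCoord_apply, add_apply, smul_apply, mulIZ_apply]
  module

theorem contDiffOn_christoffel {ε : ℝ} {b : ℝ × ℝ → ℝ} {V : Set (ℝ × ℝ)} (hV : IsOpen V)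
    (hb : ContDiffOn ℝ ∞ b V) :
    ContDiffOn ℝ ∞ (christoffel (n := n) ε b) (wCoord ⁻¹' V) := by
  have hb' : ContDiffOn ℝ ∞ (fderiv ℝ b) V := hb.fderiv_of_isOpen hV le_rfl
  exact contDiffOn_comp_smul_add_comp_smul (hb'.clm_apply contDiffOn_const)
    (hb'.clm_apply contDiffOn_const) _ _

theorem clm_apply_eq (f : ℝ × ℝ →L[ℝ] ℝ) (v : ℝ × ℝ) :
    f v = v.1 * f (1, 0) + v.2 * f (0, 1) := by
  rw [← smul_eq_mul, ← smul_eq_mul, ← map_smul, ← map_smul, ← map_add]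
  simp

theorem isLeviCivita_christoffel {ε : ℝ} (hε : ε * ε = 1) {b : ℝ × ℝ → ℝ} {V : Set (ℝ × ℝ)}
    (hV : IsOpen V) (hb : ContDiffOn ℝ ∞ b V) :
    IsLeviCivita (wCoord ⁻¹' V) (metric (n := n) ε b) (christoffel ε b) where
  smooth := contDiffOn_christoffel hV hb
  torsionFree p _ X Y := by
    have : mulZ ε X Y = mulZ ε Y X := by
      simp only [mulZ_apply]
      congr 2 <;> ring
    simp only [christoffel_apply, this]
  metric p hp X Y Z := by
    have hd : DifferentiableAt ℝ b (wCoord p) :=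
      (hb.contDiffAt (hV.mem_nhds hp)).differentiableAt (by simp)
    rw [covDerivForm, (hasFDerivAt_metric hd).fderiv, metric_symm ε b p Y]
    simp only [ContinuousLinearMap.smulRight_apply, ContinuousLinearMap.comp_apply, smul_apply,
      wCoord_apply, clm_apply_eq (fderiv ℝ b p.2.1) X.2.1, tensor, sub_apply, dw1_apply, dw2_apply,
      metric_apply, christoffel_apply, mulZ_apply, stdJ_apply]
    simp
    -- Only the ∂b/∂w² terms fail to cancel identically: the factor ε in φ meets those coming from J
    -- and g, and ε² = 1 is needed.
    linear_combination X.2.1.2 * fderiv ℝ b p.2.1 (0, 1) *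
      (ε * Y.2.1.2 * Z.2.1.2 - Y.2.1.1 * Z.2.1.1) * hε

/-- Multiplication in ℂ^ε is ε-complex bilinear, so i can be pulled out of the second factor. -/
theorem christoffel_stdJ (ε : ℝ) (b : ℝ × ℝ → ℝ) (p X Y : EpsSpace n) :
    christoffel ε b p X (stdJ ε Y) = stdJ ε (christoffel ε b p X Y) := by
  have : mulZ ε X (stdJ ε Y) = stdJ ε (mulZ ε X Y) := by
    simp only [mulZ_apply, stdJ_apply]
    refine Prod.ext (Prod.ext ?_ ?_) (Prod.ext (Prod.ext ?_ ?_) ?_) <;> simp <;> ring_nf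
    rfl
  simp only [christoffel_apply, this, map_add, map_smul]

theorem fderiv_christoffel {ε : ℝ} {b : ℝ × ℝ → ℝ} {p : EpsSpace n}
    (hb : DifferentiableAt ℝ (fderiv ℝ b) (wCoord p)) (X Y Z : EpsSpace n) :
    fderiv ℝ (christoffel ε b) p X Y Z =
      (fderiv ℝ (fun v => fderiv ℝ b v (1, 0)) (wCoord p) (wCoord X) / 2) • mulZ ε Y Z
        + (ε * fderiv ℝ (fun v => fderiv ℝ b v (0, 1)) (wCoord p) (wCoord X) / 2) •
          stdJ ε (mulZ ε Y Z) := by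
  have key := fderiv_comp_smul_add_comp_smul (L := wCoord (n := n))
    (f₁ := fun v => fderiv ℝ b v (1, 0)) (f₂ := fun v => fderiv ℝ b v (0, 1))
    (hb.clm_apply (differentiableAt_const _)) (hb.clm_apply (differentiableAt_const _))
    ((1 / 2 : ℝ) • mulZ (n := n) ε) ((ε / 2) • mulIZ ε) X
  refine (congrArg (fun T => T Y Z) key).trans ?_
  simp only [add_apply, smul_apply, mulIZ_apply]
  module

theorem fderiv_fderiv_apply_comm {b : ℝ × ℝ → ℝ} {w : ℝ × ℝ} (hb : ContDiffAt ℝ ∞ b w)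
    (u v : ℝ × ℝ) :
    fderiv ℝ (fun x => fderiv ℝ b x u) w v = fderiv ℝ (fun x => fderiv ℝ b x v) w u := by
  have hd : DifferentiableAt ℝ (fderiv ℝ b) w :=
    (hb.fderiv_right (m := 1) (by norm_cast)).differentiableAt (by simp)
  have key (u : ℝ × ℝ) := (hd.hasFDerivAt.clm_apply (hasFDerivAt_const u w)).fderiv
  rw [key, key]
  simpa using (hb.isSymmSndFDerivAt (by simp; norm_cast)).eq v u

/-! ### The curvature and its parallelism. -/

/-- The tensor `(Y, Z, W) ↦ (dw¹ ∧ dw²)(Y, Z) i Wʷ ∂_z` to which the curvature is proportional. -/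
noncomputable def curvatureModel (ε : ℝ) (Y Z W : EpsSpace n) : EpsSpace n :=
  (Y.2.1.1 * Z.2.1.2 - Y.2.1.2 * Z.2.1.1) •
    ((ε * W.2.1.2) • partialZ1 + W.2.1.1 • partialZ2)

/-- Γ takes values in vectors without w-component, and Γ kills those, so only the antisymmetrised
derivative of φ = ∂b/∂w survives. Its w-derivative is symmetric in the two directions and cancels;
what remains is ∂²b/∂w̄∂w = -(ε/4) Δ^ε b. -/
theorem curvature_christoffel {ε : ℝ} (hε : ε * ε = 1) {b : ℝ × ℝ → ℝ} {p : EpsSpace n}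
    (hb : ContDiffAt ℝ ∞ b (wCoord p)) (X Y Z : EpsSpace n) :
    curvature (christoffel ε b) p X Y Z =
      (ε / 2 * epsLaplacian ε b (wCoord p)) • curvatureModel ε X Y Z := by
  have hd : DifferentiableAt ℝ (fderiv ℝ b) (wCoord p) :=
    (hb.fderiv_right (m := 1) (by norm_cast)).differentiableAt (by simp)
  have hzero (X Y Z : EpsSpace n) :
      christoffel ε b p X (christoffel ε b p Y Z) = 0 := by
    have hw : (christoffel ε b p Y Z).2.1 = 0 := by
      simp [christoffel_apply, mulZ_apply, stdJ_apply]
    have hm : mulZ ε X (christoffel ε b p Y Z) = 0 := by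
      rw [mulZ_apply, hw]
      simp
    rw [christoffel_apply, hm]
    simp
  rw [curvature, hzero, hzero, fderiv_christoffel hd, fderiv_christoffel hd]
  rw [epsLaplacian, clm_apply_eq _ (wCoord X), clm_apply_eq _ (wCoord Y),
    clm_apply_eq (fderiv ℝ (fun v => fderiv ℝ b v (0, 1)) (wCoord p)) (wCoord X),
    clm_apply_eq (fderiv ℝ (fun v => fderiv ℝ b v (0, 1)) (wCoord p)) (wCoord Y),
    fderiv_fderiv_apply_comm hb (1, 0) (0, 1)]
  generalize fderiv ℝ (fun v => fderiv ℝ b v (1, 0)) (wCoord p) (1, 0) = b₁₁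
  generalize fderiv ℝ (fun v => fderiv ℝ b v (0, 1)) (wCoord p) (1, 0) = b₁₂
  generalize fderiv ℝ (fun v => fderiv ℝ b v (0, 1)) (wCoord p) (0, 1) = b₂₂
  simp only [mulZ_apply, stdJ_apply, curvatureModel, partialZ1, partialZ2, wCoord_apply]
  refine Prod.ext (Prod.ext ?_ ?_) (Prod.ext (Prod.ext ?_ ?_) ?_)
  · simp
    linear_combination (X.2.1.1 * Y.2.1.2 - X.2.1.2 * Y.2.1.1) / 2 *
      (b₁₁ * ε * Z.2.1.2 - b₁₂ * Z.2.1.1) * hε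
  · simp
    linear_combination (X.2.1.1 * Y.2.1.2 - X.2.1.2 * Y.2.1.1) / 2 *
      (b₁₁ * Z.2.1.1 - b₁₂ * Z.2.1.2) * hε
  · simp
  · simp
  · ext <;> simp

/-- If a connection `B` acts on the `w`-directions as multiplication by `-(α + i β)`, on the
`z`-directions dually, and the scalar `h` has logarithmic derivative `-4 α`, then the curvature
`h • curvatureModel` is parallel for `B`. -/
theorem covDerivCurvature_eq_zero {ε : ℝ}
    {B : EpsSpace n → EpsSpace n →L[ℝ] EpsSpace n →L[ℝ] EpsSpace n}
    {R : EpsSpace n → EpsSpace n → EpsSpace n → EpsSpace n → EpsSpace n}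
    {h : EpsSpace n → ℝ} {h' : EpsSpace n →L[ℝ] ℝ} {p : EpsSpace n} {α β : EpsSpace n → ℝ}
    (hR : ∀ᶠ q in nhds p, ∀ Y Z W, R q Y Z W = h q • curvatureModel ε Y Z W)
    (hh : HasFDerivAt h h' p) (hh' : ∀ X, h' X = -4 * α X * h p)
    (hB₁ : ∀ X Y, (B p X Y).2.1.1 = -(α X * Y.2.1.1 + ε * β X * Y.2.1.2))
    (hB₂ : ∀ X Y, (B p X Y).2.1.2 = -(α X * Y.2.1.2 + β X * Y.2.1.1))
    (hBz₁ : ∀ X, B p X partialZ1 = α X • partialZ1 - β X • partialZ2)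
    (hBz₂ : ∀ X, B p X partialZ2 = α X • partialZ2 - (ε * β X) • partialZ1)
    (X Y Z W : EpsSpace n) : covDerivCurvature B R p X Y Z W = 0 := by
  have hRp := hR.self_of_nhds
  have hd : HasFDerivAt (fun q => R q Y Z W) (h'.smulRight (curvatureModel ε Y Z W)) p :=
    (hh.smul_const _).congr_of_eventuallyEq (hR.mono fun q hq => hq Y Z W)
  rw [covDerivCurvature, hd.fderiv]
  -- Weights: the area form on (Y, Z) contributes minus the trace on the w-plane, 2α; the argument W
  -- contributes α + iβ and the output α - iβ. The sum 4α cancels the derivative of h, and β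
  -- disappears.
  simp only [hRp, ContinuousLinearMap.smulRight_apply, hh', curvatureModel, map_smul, map_add,
    hBz₁, hBz₂, hB₁, hB₂]
  module

/-! ### S_X as an ε-complex multiplier on the w- and z-directions. -/

section Multiplier

variable {ε : ℝ} (lam : ℝ) (b : ℝ × ℝ → ℝ) (p X Y : EpsSpace n) (x₁ x₂ : ℝ)

/-- Since ξ and Jξ lie in the z-directions, they add nothing to the w-components, and g(ξ, ·) sees
neither b nor the z-components. What is left is multiplication of Yʷ by α + iβ, with λ entering only
β, through the ζ-term; this is its real part. -/
theorem linearTypeTensor_metric_w1 (hε : ε * ε = 1) :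
    (linearTypeTensor ε (metric ε b p) (stdJ ε) (x₁ • partialZ1 + x₂ • partialZ2)
      (lam • (x₁ • partialZ1 + x₂ • partialZ2)) X Y).2.1.1 =
      (ε * x₂ * X.2.1.2 - x₁ * X.2.1.1) * Y.2.1.1
        + ε * ((1 + 2 * lam * ε) * (x₂ * X.2.1.1 - x₁ * X.2.1.2)) * Y.2.1.2 := by
  simp [linearTypeTensor_apply, metric_apply, stdJ_apply, partialZ1, partialZ2]
  linear_combination ε * X.2.1.2 * (x₂ * Y.2.1.1 - x₁ * Y.2.1.2) * hε

theorem linearTypeTensor_metric_w2 (hε : ε * ε = 1) :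
    (linearTypeTensor ε (metric ε b p) (stdJ ε) (x₁ • partialZ1 + x₂ • partialZ2)
      (lam • (x₁ • partialZ1 + x₂ • partialZ2)) X Y).2.1.2 =
      (ε * x₂ * X.2.1.2 - x₁ * X.2.1.1) * Y.2.1.2
        + (1 + 2 * lam * ε) * (x₂ * X.2.1.1 - x₁ * X.2.1.2) * Y.2.1.1 := by
  simp [linearTypeTensor_apply, metric_apply, stdJ_apply, partialZ1, partialZ2]
  linear_combination X.2.1.1 * (x₂ * Y.2.1.1 - x₁ * Y.2.1.2) * hε

/-- Here g(ξ, ·) vanishes on ∂_z and J∂_z. The multiplier is -(α - iβ), as skewness forces: g pairs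
z with w, and the adjoint of i is -i. -/
theorem linearTypeTensor_metric_partialZ1 (hε : ε * ε = 1) :
    linearTypeTensor ε (metric ε b p) (stdJ ε) (x₁ • partialZ1 + x₂ • partialZ2)
      (lam • (x₁ • partialZ1 + x₂ • partialZ2)) X partialZ1 =
      ((1 + 2 * lam * ε) * (x₂ * X.2.1.1 - x₁ * X.2.1.2)) • partialZ2
        - (ε * x₂ * X.2.1.2 - x₁ * X.2.1.1) • partialZ1 := by
  simp only [linearTypeTensor_apply, metric_apply, stdJ_apply, partialZ1, partialZ2]
  refine Prod.ext (Prod.ext ?_ ?_) (Prod.ext (Prod.ext ?_ ?_) ?_)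
  · simp
    linear_combination (-ε * X.2.1.2 * x₂) * hε
  · simp
    linear_combination (-X.2.1.2 * x₁) * hε
  · simp
  · simp
  · ext <;> simp

theorem linearTypeTensor_metric_partialZ2 (hε : ε * ε = 1) :
    linearTypeTensor ε (metric ε b p) (stdJ ε) (x₁ • partialZ1 + x₂ • partialZ2)
      (lam • (x₁ • partialZ1 + x₂ • partialZ2)) X partialZ2 =
      (ε * ((1 + 2 * lam * ε) * (x₂ * X.2.1.1 - x₁ * X.2.1.2))) • partialZ1
        - (ε * x₂ * X.2.1.2 - x₁ * X.2.1.1) • partialZ2 := by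
  simp only [linearTypeTensor_apply, metric_apply, stdJ_apply, partialZ1, partialZ2]
  refine Prod.ext (Prod.ext ?_ ?_) (Prod.ext (Prod.ext ?_ ?_) ?_)
  · simp
    linear_combination ε * X.2.1.1 * x₂ * hε
  · simp
    linear_combination X.2.1.1 * x₁ * hε
  · simp
  · simp
  · ext <;> simp

theorem christoffel_apply_w (ε : ℝ) : (christoffel ε b p X Y).2.1 = 0 := by
  simp [christoffel_apply, mulZ_apply, stdJ_apply]

theorem christoffel_apply_eq_zero (ε : ℝ) (hY : Y.2.1 = 0) : christoffel ε b p X Y = 0 := by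
  have hm : mulZ ε X Y = 0 := by
    rw [mulZ_apply, hY]
    simp
  rw [christoffel_apply, hm]
  simp

end Multiplier

/-! ### From structure equations to a homogeneous structure. -/

theorem isEpsKahler {ε : ℝ} (hε : ε * ε = 1) {b : ℝ × ℝ → ℝ} {V : Set (ℝ × ℝ)} (hV : IsOpen V)
    (hb : ContDiffOn ℝ ∞ b V) :
    IsEpsKahler ε (wCoord (n := n) ⁻¹' V) (metric ε b) (fun _ => stdJ ε) where
  metric :=
    { isOpen := hV.preimage wCoord.continuous
      smooth := contDiffOn_metric hb
      symm := fun p _ => metric_symm ε b p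
      nondegenerate := fun p _ => metric_nondegenerate (by rintro rfl; simp at hε) b p }
  smooth := contDiffOn_const
  skew p _ := metric_stdJ_skew ε b p
  sq _ _ := stdJ_stdJ ε
  parallel := ⟨christoffel ε b, isLeviCivita_christoffel hε hV hb, fun p _ X Y => by
    simp [covDerivEndo, christoffel_stdJ]⟩

/-- A field `ξ = x₁ ∂_{z¹} + x₂ ∂_{z²}` defines a degenerate structure of linear type if its
coefficients and the curvature factor `h` satisfy the equations that make `ξ` and `R` parallel. -/
theorem isDegenerateLinearType_of_structureEquations {ε lam : ℝ} (hε : ε * ε = 1)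
    {b : ℝ × ℝ → ℝ} {V : Set (ℝ × ℝ)} (hV : IsOpen V) (hb : ContDiffOn ℝ ∞ b V)
    {x₁ x₂ h : EpsSpace n → ℝ} (hx₁ : ContDiffOn ℝ ∞ x₁ (wCoord ⁻¹' V))
    (hx₂ : ContDiffOn ℝ ∞ x₂ (wCoord ⁻¹' V)) (hh : DifferentiableOn ℝ h (wCoord ⁻¹' V))
    (dx₁ : ∀ p ∈ wCoord ⁻¹' V, ∀ X, fderiv ℝ x₁ p X =
      ε * ((1 + 2 * lam * ε) * (x₂ p * X.2.1.1 - x₁ p * X.2.1.2)) * x₂ p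
        - (ε * x₂ p * X.2.1.2 - x₁ p * X.2.1.1) * x₁ p)
    (dx₂ : ∀ p ∈ wCoord ⁻¹' V, ∀ X, fderiv ℝ x₂ p X =
      (1 + 2 * lam * ε) * (x₂ p * X.2.1.1 - x₁ p * X.2.1.2) * x₁ p
        - (ε * x₂ p * X.2.1.2 - x₁ p * X.2.1.1) * x₂ p)
    (dh : ∀ p ∈ wCoord ⁻¹' V, ∀ X, fderiv ℝ h p X =
      -4 * (ε * x₂ p * X.2.1.2 - x₁ p * X.2.1.1) * h p)
    (laplacian : ∀ p ∈ wCoord ⁻¹' V, ε / 2 * epsLaplacian ε b (wCoord p) = h p) :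
    IsDegenerateLinearType ε (wCoord ⁻¹' V) (metric ε b) (fun _ => stdJ ε)
      (fun p => x₁ p • partialZ1 + x₂ p • partialZ2)
      (fun p => lam • (x₁ p • partialZ1 + x₂ p • partialZ2))
      (fun p => linearTypeTensor ε (metric ε b p) (stdJ ε) (x₁ p • partialZ1 + x₂ p • partialZ2)
        (lam • (x₁ p • partialZ1 + x₂ p • partialZ2))) := by
  set ξ : EpsSpace n → EpsSpace n := fun p => x₁ p • partialZ1 + x₂ p • partialZ2 with hξ_def
  have hU : IsOpen (wCoord (n := n) ⁻¹' V) := hV.preimage wCoord.continuous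
  have hξ : ContDiffOn ℝ ∞ ξ (wCoord ⁻¹' V) :=
    (hx₁.smul contDiffOn_const).add (hx₂.smul contDiffOn_const)
  have hζ : ContDiffOn ℝ ∞ (fun p => lam • ξ p) (wCoord ⁻¹' V) := hξ.const_smul lam
  have hS := contDiffOn_linearTypeTensor (ε := ε) (J := stdJ ε) (contDiffOn_metric (ε := ε) hb) hξ hζ
  have hLC := isLeviCivita_christoffel (n := n) hε hV hb
  set S := fun p => linearTypeTensor ε (metric ε b p) (stdJ ε) (ξ p) (lam • ξ p)
  have parallel_g : ∀ p ∈ wCoord ⁻¹' V, ∀ X Y Z,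
      covDerivForm (christoffel (n := n) ε b - S) (metric ε b) p X Y Z = 0 := fun p hp X Y Z => by
    have h₁ := hLC.metric p hp X Y Z
    have h₂ := linearTypeTensor_skew (ε := ε) (metric_symm ε b p) (metric_stdJ_skew ε b p) (ξ p)
      (lam • ξ p) X Y Z
    simp only [covDerivForm, Pi.sub_apply, sub_apply, map_sub, S] at h₁ ⊢
    linarith
  have comm_J : ∀ p X Y, (christoffel (n := n) ε b - S) p X (stdJ ε Y) =
      stdJ ε ((christoffel (n := n) ε b - S) p X Y) := fun p X Y => by
    simp only [Pi.sub_apply, sub_apply, map_sub, christoffel_stdJ, S]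
    rw [linearTypeTensor_comm hε (stdJ_stdJ ε)]
  have hz₁ : ∀ p X, (christoffel (n := n) ε b - S) p X partialZ1 =
      (ε * x₂ p * X.2.1.2 - x₁ p * X.2.1.1) • partialZ1
        - ((1 + 2 * lam * ε) * (x₂ p * X.2.1.1 - x₁ p * X.2.1.2)) • partialZ2 := fun p X => by
    simp only [Pi.sub_apply, sub_apply, S, ξ, linearTypeTensor_metric_partialZ1 _ _ _ _ _ _ hε,
      christoffel_apply_eq_zero b p X partialZ1 ε rfl, zero_sub, neg_sub]
  have hz₂ : ∀ p X, (christoffel (n := n) ε b - S) p X partialZ2 =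
      (ε * x₂ p * X.2.1.2 - x₁ p * X.2.1.1) • partialZ2
        - (ε * ((1 + 2 * lam * ε) * (x₂ p * X.2.1.1 - x₁ p * X.2.1.2))) • partialZ1 :=
      fun p X => by
    simp only [Pi.sub_apply, sub_apply, S, ξ, linearTypeTensor_metric_partialZ2 _ _ _ _ _ _ hε,
      christoffel_apply_eq_zero b p X partialZ2 ε rfl, zero_sub, neg_sub]
  refine ⟨⟨⟨isEpsKahler hε hV hb, hS, christoffel ε b, hLC, parallel_g, ?_, ?_, ?_⟩, hξ, hζ, ?_⟩, ?_⟩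
  · intro p hp X Y Z W
    refine covDerivCurvature_eq_zero (h := h) (α := fun X => ε * x₂ p * X.2.1.2 - x₁ p * X.2.1.1)
      (β := fun X => (1 + 2 * lam * ε) * (x₂ p * X.2.1.1 - x₁ p * X.2.1.2)) ?_
      (hh.differentiableAt (hU.mem_nhds hp)).hasFDerivAt (dh p hp) ?_ ?_ (hz₁ p) (hz₂ p) X Y Z W
    -- The formula for R is needed on a neighbourhood, since R is differentiated at `p`.
    · filter_upwards [hU.mem_nhds hp] with q hq Y Z W
      rw [curvature_christoffel hε (hb.contDiffAt (hV.mem_nhds hq)), laplacian q hq]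
    · intro X Y
      simp only [Pi.sub_apply, sub_apply, S, ξ, Prod.fst_sub, Prod.snd_sub, christoffel_apply_w,
        linearTypeTensor_metric_w1 _ _ _ _ _ _ _ hε, zero_sub, Prod.fst_neg]
    · intro X Y
      simp only [Pi.sub_apply, sub_apply, S, ξ, Prod.fst_sub, Prod.snd_sub, christoffel_apply_w,
        linearTypeTensor_metric_w2 _ _ _ _ _ _ _ hε, zero_sub, Prod.snd_neg]
  · intro p hp X Y Z
    have hd₁ : DifferentiableAt ℝ x₁ p :=
      (hx₁.contDiffAt (hU.mem_nhds hp)).differentiableAt (by simp)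
    have hd₂ : DifferentiableAt ℝ x₂ p :=
      (hx₂.contDiffAt (hU.mem_nhds hp)).differentiableAt (by simp)
    have dξ : HasFDerivAt ξ ((fderiv ℝ x₁ p).smulRight partialZ1
        + (fderiv ℝ x₂ p).smulRight partialZ2) p :=
      (hd₁.hasFDerivAt.smul_const _).add (hd₂.hasFDerivAt.smul_const _)
    refine covDerivTensor_linearTypeTensor
      (((contDiffOn_metric hb).contDiffAt (hU.mem_nhds hp)).differentiableAt (by simp))
      dξ.differentiableAt ((hS.contDiffAt (hU.mem_nhds hp)).differentiableAt (by simp))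
      (parallel_g p hp) (comm_J p) (fun X => ?_) X Y Z
    -- The remaining goal is dx = -(α - iβ) x, split into real and imaginary parts by `dx₁` and
    -- `dx₂`.
    rw [dξ.fderiv]
    simp only [hξ_def, map_add, map_smul, hz₁, hz₂, add_apply, ContinuousLinearMap.smulRight_apply,
      dx₁ p hp, dx₂ p hp]
    module
  · intro p _ X Y
    rw [covDerivEndo, comm_J]
    simp
  · intro p _ X Y
    exact linearTypeTensor_apply ..
  · intro p _
    simp [ξ, metric_apply, partialZ1, partialZ2]

/-! ### Solving the structure equations for the two values of λ. -/

theorem isOpen_normSq_ne_zero (ε lam : ℝ) : IsOpen {w | normSq ε lam w ≠ 0} := by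
  refine isOpen_ne.preimage ?_
  unfold normSq
  split_ifs <;> fun_prop

theorem hasFDerivAt_inv_comp {N : EpsSpace n → ℝ} {N' : EpsSpace n →L[ℝ] ℝ} {p : EpsSpace n}
    (hN : HasFDerivAt N N' p) (h0 : N p ≠ 0) :
    HasFDerivAt (fun q => (N q)⁻¹) (-(N p ^ 2)⁻¹ • N') p :=
  (hasDerivAt_inv h0).comp_hasFDerivAt p hN

/-- With N = w w̄ the coefficient of ξ is x = -w/N = -1/w̄. Then α + iβ = dw/w, so dx = dw̄/w̄² is
the required equation, and h, a multiple of N⁻², has logarithmic derivative -2 dN/N = -4α. -/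
theorem isDegenerateLinearType_zero {ε : ℝ} (hε : ε * ε = 1) {R₀ : ℝ} {b : ℝ × ℝ → ℝ}
    (hb : ContDiffOn ℝ ∞ b {w | normSq ε 0 w ≠ 0})
    (hΔ : ∀ w, normSq ε 0 w ≠ 0 → epsLaplacian ε b w = R₀ / normSq ε 0 w ^ 2) :
    IsDegenerateLinearType ε (regularSet n ε 0) (metric ε b) (fun _ => stdJ ε) (xi ε 0)
      (fun p => (0 : ℝ) • xi ε 0 p)
      (fun p => linearTypeTensor ε (metric ε b p) (stdJ ε) (xi ε 0 p) ((0 : ℝ) • xi ε 0 p)) := by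
  set N : EpsSpace n → ℝ := fun p => dw1 p ^ 2 - ε * dw2 p ^ 2
  have hN (p : EpsSpace n) : normSq ε 0 (wCoord p) = N p := by simp [normSq, N]
  have hxi : (xi ε 0 : EpsSpace n → EpsSpace n) = fun p =>
      (-(N p)⁻¹ * dw1 p) • partialZ1 + (-(N p)⁻¹ * dw2 p) • partialZ2 := by
    funext p
    rw [xi, if_pos rfl, smul_add, smul_smul, smul_smul]
    simp only [N, neg_div, one_div]
  have hsmooth : ContDiffOn ℝ ∞ (fun p => -(N p)⁻¹) (wCoord ⁻¹' {w | normSq ε 0 w ≠ 0}) := by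
    refine (ContDiffOn.inv ?_ fun p hp => ?_).neg
    · exact (((dw1.contDiff.pow 2).sub (contDiff_const.mul (dw2.contDiff.pow 2)))).contDiffOn
    · rw [← hN]; exact hp
  have dN (p : EpsSpace n) : HasFDerivAt N ((2 * dw1 p) • dw1 - (ε * (2 * dw2 p)) • dw2) p := by
    refine ((dw1.hasFDerivAt.pow 2).sub ((dw2.hasFDerivAt.pow 2).const_mul ε)).congr_fderiv ?_
    ext X <;> simp
  have dy (p : EpsSpace n) (hp : N p ≠ 0) := hasFDerivAt_inv_comp (dN p) hp
  have dh (p : EpsSpace n) (hp : N p ≠ 0) := (((dy p hp).pow 2).const_mul R₀).const_mul (ε / 2)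
  rw [hxi]
  refine isDegenerateLinearType_of_structureEquations
    (h := fun p => ε / 2 * (R₀ * (N p)⁻¹ ^ 2)) hε (isOpen_normSq_ne_zero ε 0) hb
    (hsmooth.mul dw1.contDiff.contDiffOn) (hsmooth.mul dw2.contDiff.contDiffOn) ?_ ?_ ?_ ?_ ?_
  · intro p hp
    exact (dh p (by rw [← hN]; exact hp)).differentiableAt.differentiableWithinAt
  · intro p hp X
    have h0 : N p ≠ 0 := by rw [← hN]; exact hp
    rw [((dy p h0).fun_neg.fun_mul dw1.hasFDerivAt).fderiv]
    simp [-neg_smul]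
    -- `N` stays folded while denominators are cleared; only the resulting polynomial identity needs
    -- its expansion.
    field_simp
    simp only [N, dw1_apply, dw2_apply]
    ring
  · intro p hp X
    have h0 : N p ≠ 0 := by rw [← hN]; exact hp
    rw [((dy p h0).fun_neg.fun_mul dw2.hasFDerivAt).fderiv]
    simp [-neg_smul]
    field_simp
    simp only [N, dw1_apply, dw2_apply]
    ring
  · intro p hp X
    have h0 : N p ≠ 0 := by rw [← hN]; exact hp
    rw [(dh p h0).fderiv]
    simp [-neg_smul]
    field_simp
    ring
  · intro p hp
    rw [hΔ _ hp, hN, inv_pow, ← div_eq_mul_inv R₀]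

/-- The hypothesis `hlam` makes β vanish, so the real x = -1/w¹ stays real. With α = dw¹/w¹, both dx
= -αx and dh = -4αh for h a multiple of (w¹)⁻⁴ are one-variable identities. -/
theorem isDegenerateLinearType_of_ne_zero {ε lam : ℝ} (hε : ε * ε = 1) (hlam : 1 + 2 * lam * ε = 0)
    {R₀ : ℝ} {b : ℝ × ℝ → ℝ} (hb : ContDiffOn ℝ ∞ b {w | normSq ε lam w ≠ 0})
    (hΔ : ∀ w, normSq ε lam w ≠ 0 → epsLaplacian ε b w = R₀ / normSq ε lam w ^ 2) :
    IsDegenerateLinearType ε (regularSet n ε lam) (metric ε b) (fun _ => stdJ ε) (xi ε lam)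
      (fun p => lam • xi ε lam p)
      (fun p => linearTypeTensor ε (metric ε b p) (stdJ ε) (xi ε lam p) (lam • xi ε lam p)) := by
  have hlam0 : lam ≠ 0 := by rintro rfl; simp at hlam
  have hN (p : EpsSpace n) : normSq ε lam (wCoord p) = dw1 p ^ 2 := by simp [normSq, hlam0]
  have hne (p : EpsSpace n) (hp : p ∈ wCoord ⁻¹' {w | normSq ε lam w ≠ 0}) : dw1 p ≠ 0 := by
    have : normSq ε lam (wCoord p) ≠ 0 := hp
    rw [hN] at this
    exact ne_zero_pow two_ne_zero this
  have hxi : (xi ε lam : EpsSpace n → EpsSpace n) = fun p =>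
      (-(dw1 p)⁻¹) • partialZ1 + (0 : ℝ) • partialZ2 := by
    funext p
    rw [xi, if_neg hlam0, zero_smul, add_zero, neg_div, one_div]
  have dy (p : EpsSpace n) (hp : dw1 p ≠ 0) := hasFDerivAt_inv_comp dw1.hasFDerivAt hp
  have dh (p : EpsSpace n) (hp : dw1 p ≠ 0) := (((dy p hp).pow 4).const_mul R₀).const_mul (ε / 2)
  rw [hxi]
  refine isDegenerateLinearType_of_structureEquations
    (h := fun p => ε / 2 * (R₀ * (dw1 p)⁻¹ ^ 4)) hε (isOpen_normSq_ne_zero ε lam) hb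
    (dw1.contDiff.contDiffOn.inv hne).neg contDiffOn_const ?_ ?_ ?_ ?_ ?_
  · intro p hp
    exact (dh p (hne p hp)).differentiableAt.differentiableWithinAt
  · intro p hp X
    have h0 := hne p hp
    rw [(dy p h0).fun_neg.fderiv, hlam]
    simp at h0 ⊢
    field_simp
  · intro p hp X
    rw [hlam]
    simp
  · intro p hp X
    have h0 := hne p hp
    rw [(dh p h0).fderiv]
    simp at h0 ⊢
    field_simp
  · intro p hp
    rw [hΔ _ hp, hN, inv_pow, ← div_eq_mul_inv R₀, ← pow_mul]

end EpsSpace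

theorem proposition4p3 (n : ℕ) (ε lam : ℝ) (hε : ε = -1 ∨ ε = 1)
    (hlam : lam = 0 ∨ lam = -ε / 2) (R₀ : ℝ) (b : ℝ × ℝ → ℝ)
    (hb_smooth : ContDiffOn ℝ ∞ b {w | EpsSpace.normSq ε lam w ≠ 0})
    (hb : ∀ w, EpsSpace.normSq ε lam w ≠ 0 →
      EpsSpace.epsLaplacian ε b w = R₀ / EpsSpace.normSq ε lam w ^ 2) :
    IsEpsKahler ε (EpsSpace.regularSet n ε lam) (EpsSpace.metric ε b)
      (fun _ => EpsSpace.stdJ ε) ∧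
    ∃ S : EpsSpace n → EpsSpace n →L[ℝ] EpsSpace n →L[ℝ] EpsSpace n,
      IsDegenerateLinearType ε (EpsSpace.regularSet n ε lam) (EpsSpace.metric ε b)
        (fun _ => EpsSpace.stdJ ε) (EpsSpace.xi ε lam) (fun p => lam • EpsSpace.xi ε lam p) S ∧
      (lam = 0 →
        IsStronglyDegenerateLinearType ε (EpsSpace.regularSet n ε lam) (EpsSpace.metric ε b)
          (fun _ => EpsSpace.stdJ ε) (EpsSpace.xi ε lam)
          (fun p => lam • EpsSpace.xi ε lam p) S) := by
  have hε2 : ε * ε = 1 := by rcases hε with rfl | rfl <;> norm_num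
  refine ⟨EpsSpace.isEpsKahler hε2 (EpsSpace.isOpen_normSq_ne_zero ε lam) hb_smooth,
    fun p => linearTypeTensor ε (EpsSpace.metric ε b p) (EpsSpace.stdJ ε) (EpsSpace.xi ε lam p)
      (lam • EpsSpace.xi ε lam p), ?_⟩
  have main : IsDegenerateLinearType ε (EpsSpace.regularSet n ε lam) (EpsSpace.metric ε b)
      (fun _ => EpsSpace.stdJ ε) (EpsSpace.xi ε lam) (fun p => lam • EpsSpace.xi ε lam p)
      (fun p => linearTypeTensor ε (EpsSpace.metric ε b p) (EpsSpace.stdJ ε)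
        (EpsSpace.xi ε lam p) (lam • EpsSpace.xi ε lam p)) := by
    rcases hlam with rfl | hlam
    · exact EpsSpace.isDegenerateLinearType_zero hε2 hb_smooth hb
    · refine EpsSpace.isDegenerateLinearType_of_ne_zero hε2 ?_ hb_smooth hb
      rw [hlam]
      -- The value λ = -ε/2 is exactly the one that removes β: 1 + 2λε = 1 - ε² = 0.
      linear_combination -hε2
  exact ⟨main, fun h => ⟨main, fun p _ => by rw [h, zero_smul]⟩⟩
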